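/- Let $F$ be a field of characteristic $0$, let $H$ be a finite-dimensional unital associative $F$-algebra, and let $L$ be a finite-dimensional semisimple Lie algebra over $F$ with a generalized action of $H$, i.e. a homomorphism of unital algebras $\rho\colon H\to \mathrm{End}_F(L)$, written $hl=\rho(h)(l)$, such that for every $h\in H$ there are $h_1',h_1'',\dots,h_k',h_k''\in H$ with $h[l_1,l_2]=\sum_{i=1}^k[h_i'l_1,h_i''l_2]$ for all $l_1,l_2\in L$. Suppose that $L$ is $H$-simple, i.e. $L$ is non-abelian and its only $H$-invariant ideals are $0$ and $L$. Suppose moreover that $F$ is algebraically closed or, more generally, that the only $F$-linear maps $L\to L$ commuting with all $\mathrm{ad}\,l$ ($l\in L$) and all $\rho(h)$ ($h\in H$) are the scalars. Let $L(X\mid H)$ be the free Lie algebra over $F$ on the symbols $x_i^{\gamma}$, where $i\ge 1$ and $\gamma$ runs over a basis of $H$; for $h=\sum_\gamma a_\gamma\gamma\in H$ put $x_i^h=\sum_\gamma a_\gamma x_i^\gamma$. Let $\mathrm{Id}^H(L)$ be the ideal of all $f\in L(X\mid H)$ that vanish under every substitution $x_i^h\mapsto h\,l_i$ with $l_1,l_2,\ldots\in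 L$. Let $V_n^H$ be the span of the left-normed commutators $[x_{\sigma(1)}^{h_1},\dots,x_{\sigma(n)}^{h_n}]$ with $\sigma\in S_n$ and $h_1,\dots,h_n\in H$, and let $c_n^H(L)$ be the dimension of the image of $V_n^H$ in $L(X\mid H)/\mathrm{Id}^H(L)$. Then $c_n^H(L)\le(\dim_F L)^{n+1}$ for all $n$, and the $H$-exponent $\exp^H(L)=\lim_{n\to\infty}\sqrt[n]{c_n^H(L)}$ exists and equals $\dim_F L$. -/

import Mathlib

open Filter Topology

noncomputable section

namespace HLie

variable {F H L : Type*} [Field F] [Ring H] [Algebra F H] [LieRing L] [LieAlgebra F L]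

/-- A generalized action of the unital associative algebra `H` on the Lie algebra `L`: a
homomorphism `ρ : H → End_F(L)` such that for every `h` there are finitely many `h'ᵢ, h''ᵢ ∈ H`
with `h [l₁, l₂] = ∑ᵢ [h'ᵢ l₁, h''ᵢ l₂]` for all `l₁, l₂ ∈ L`. -/
def IsGeneralizedAction (ρ : H →ₐ[F] Module.End F L) : Prop :=
  ∀ h : H, ∃ (k : ℕ) (h' h'' : Fin k → H), ∀ l₁ l₂ : L,
    ρ h ⁅l₁, l₂⁆ = ∑ i, ⁅ρ (h' i) l₁, ρ (h'' i) l₂⁆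

/-- `L` is `H`-simple: it is non-abelian and its only `H`-invariant ideals are `0` and `L`. -/
def IsHSimple (ρ : H →ₐ[F] Module.End F L) : Prop :=
  ¬ IsLieAbelian L ∧
    ∀ I : LieIdeal F L, (∀ (h : H), ∀ x ∈ I, ρ h x ∈ I) → I = ⊥ ∨ I = ⊤

/-- `L` is central with respect to the `H`-action: the only `F`-linear maps `L → L` that commute
with `ad L` and with the action of `H` are the scalars. -/
def IsHCentral (ρ : H →ₐ[F] Module.End F L) : Prop :=
  ∀ φ : Module.End F L, (∀ x y : L, φ ⁅x, y⁆ = ⁅x, φ y⁆) →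
    (∀ (h : H) (x : L), φ (ρ h x) = ρ h (φ x)) → ∃ c : F, ∀ x : L, φ x = c • x

variable (F H) in
/-- A basis `(γ_β)` of `H`. -/
def basisH : Module.Basis (Module.Free.ChooseBasisIndex F H) F H :=
  Module.Free.chooseBasis F H

variable (F H) in
/-- The algebra `L(X | H)` of Lie `H`-polynomials in the variables `X = {x₀, x₁, …}`: the free Lie
algebra on the formal generators `x_i^{γ_β}`, where `(γ_β)` is a basis of `H`. -/
abbrev FreeHLie : Type _ := FreeLieAlgebra F (ℕ × Module.Free.ChooseBasisIndex F H)

variable (F) in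
/-- The element `x_i^h` of `L(X | H)`, for arbitrary `h ∈ H`; it is linear in `h`. -/
def var (i : ℕ) (h : H) : FreeHLie F H :=
  ((basisH F H).repr h).sum fun β a => a • FreeLieAlgebra.of F (i, β)

/-- The evaluation `L(X | H) → L` at `l₀, l₁, … ∈ L`: the homomorphism of Lie algebras with
`x_i^h ↦ h l_i`. -/
def eval (ρ : H →ₐ[F] Module.End F L) (l : ℕ → L) : FreeHLie F H →ₗ⁅F⁆ L :=
  FreeLieAlgebra.lift F fun p => ρ (basisH F H p.2) (l p.1)

theorem eval_var (ρ : H →ₐ[F] Module.End F L) (l : ℕ → L) (i : ℕ) (h : H) :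
    eval ρ l (var F i h) = ρ h (l i) := by
  have h1 : eval ρ l (var F i h) =
      ((basisH F H).repr h).sum fun β a => a • ρ (basisH F H β) (l i) := by
    simp only [var, Finsupp.sum]
    rw [← LieHom.coe_toLinearMap, map_sum]
    refine Finset.sum_congr rfl fun β _ => ?_
    simp [eval]
  rw [h1]
  conv_rhs => rw [← (basisH F H).linearCombination_repr h]
  simp [Finsupp.linearCombination_apply, Finsupp.sum, LinearMap.sum_apply]

/-- The ideal `Id^H(L)` of polynomial `H`-identities of `L`: the `H`-polynomials that vanish under
every evaluation in `L`. -/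
def identities (ρ : H →ₐ[F] Module.End F L) : LieIdeal F (FreeHLie F H) :=
  ⨅ l : ℕ → L, (eval ρ l).ker

/-- The left-normed commutator `[a₁, …, aₙ] = [[a₁, …, aₙ₋₁], aₙ]`. -/
def leftNormed {A : Type*} [LieRing A] : List A → A
  | [] => 0
  | a :: as => as.foldl (fun u v => ⁅u, v⁆) a

variable (F H) in
/-- The space `V_n^H` of multilinear `H`-polynomials in `n` variables, spanned by
the commutators `[x_{σ(1)}^{h₁}, …, x_{σ(n)}^{hₙ}]` with `σ ∈ S_n` and `hᵢ ∈ H`. -/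
def multilinear (n : ℕ) : Submodule F (FreeHLie F H) :=
  Submodule.span F (Set.range fun p : Equiv.Perm (Fin n) × (Fin n → H) =>
    leftNormed (List.ofFn fun j : Fin n => var F (p.1 j : ℕ) (p.2 j)))

/-- The `H`-codimension `c_n^H(L)`: the dimension of the space of multilinear elements in `n` free
generators of the relatively free algebra `L(X | H) / Id^H(L)`. -/
def codim (ρ : H →ₐ[F] Module.End F L) (n : ℕ) : ℕ :=
  Module.finrank F ((multilinear F H n).map (identities ρ).toSubmodule.mkQ)

/-- The `H`-exponent of `L` exists and equals `d`: `lim (c_n^H(L))^{1/n} = d`. -/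
def HasHExponent (ρ : H →ₐ[F] Module.End F L) (d : ℝ) : Prop :=
  Tendsto (fun n : ℕ => (codim ρ n : ℝ) ^ (1 / (n : ℝ))) atTop (𝓝 d)

end HLie

end

/-! Put d = dim L. The upper bound holds because a multilinear polynomial is determined modulo
identities by its values on tuples of basis vectors, that is, by a function from d^n points to L.

For the lower bound, functions from a finite set Ω to L are substituted for the variables: the
dimension of the space of values so obtained is at most the codimension. It thus suffices to realize
many linearly independent functions, all with the same arguments.

Polynomials with determinants as values are built first. By the density theorem, `ad L` and `ρ H`
generate End L, so some product of operators ad (A_i x_i), applied to a fixed vector, has nonzero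
alternatization; being alternating in d arguments, it is det(x) times a vector
(`alternatization_adProd_ne_zero`, `alternating_eq_det_smul`). Replacing each argument in turn by
[u, [v, a_i]] and summing multiplies this value by the Killing form of u and v. The Killing form is
nondegenerate, so its Gram determinants supply further pairs of determinants
(`IsDetPoly.det_mul_det_smul`).

The points of Ω are then families w of K balanced words, and each variable is the function reading
off the basis vector named by one letter. For each w the variables can be grouped into columns so
that the product of the column determinants is nonzero at w only (`eq_of_columns_injective`). Hence
|Ω| is at most the codimension, and there are enough balanced words for every growth rate below d.
-/

noncomputable section

namespace HLie

variable {F H L : Type*} [Field F] [Ring H] [Algebra F H] [LieRing L] [LieAlgebra F L]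

/-! ### Values of multilinear H-polynomials -/

/-- Functions with values in a Lie ring form a Lie ring under the pointwise bracket. -/
instance functionLieRing {Ω A : Type*} [LieRing A] : LieRing (Ω → A) where
  bracket f g := fun ω => ⁅f ω, g ω⁆
  add_lie _ _ _ := funext fun _ => add_lie _ _ _
  lie_add _ _ _ := funext fun _ => lie_add _ _ _
  lie_self _ := funext fun _ => lie_self _
  leibniz_lie _ _ _ := funext fun _ => leibniz_lie _ _ _

@[simp]
theorem function_lie_apply {Ω A : Type*} [LieRing A] (f g : Ω → A) (ω : Ω) :
    ⁅f, g⁆ ω = ⁅f ω, g ω⁆ := rfl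

/-- Functions with values in a Lie algebra form a Lie algebra under the pointwise bracket. -/
instance functionLieAlgebra {Ω : Type*} : LieAlgebra F (Ω → L) where
  lie_smul _ _ _ := funext fun _ => lie_smul _ _ _

/-- `IsPoly ρ s f`: the function `f : Ω → L` is a value of a multilinear Lie `H`-polynomial in
which each member of the multiset `s` of functions is substituted for exactly one variable. -/
inductive IsPoly (ρ : H →ₐ[F] Module.End F L) {Ω : Type*} : Multiset (Ω → L) → (Ω → L) → Prop
  | act (h : H) (a : Ω → L) : IsPoly ρ {a} (fun ω => ρ h (a ω))
  | lie {s t : Multiset (Ω → L)} {f g : Ω → L} :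
      IsPoly ρ s f → IsPoly ρ t g → IsPoly ρ (s + t) ⁅f, g⁆
  | zero (s : Multiset (Ω → L)) : IsPoly ρ s 0
  | add {s : Multiset (Ω → L)} {f g : Ω → L} :
      IsPoly ρ s f → IsPoly ρ s g → IsPoly ρ s (f + g)
  | smul {s : Multiset (Ω → L)} {f : Ω → L} (c : F) : IsPoly ρ s f → IsPoly ρ s (c • f)

namespace IsPoly

variable {ρ : H →ₐ[F] Module.End F L} {Ω : Type*} {s t : Multiset (Ω → L)} {f g : Ω → L}

theorem of_self (a : Ω → L) : IsPoly ρ {a} a := by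
  simpa using IsPoly.act (ρ := ρ) 1 a

theorem sum {ι : Type*} (A : Finset ι) (f : ι → Ω → L) (hf : ∀ i ∈ A, IsPoly ρ s (f i)) :
    IsPoly ρ s (∑ i ∈ A, f i) := by
  classical
  induction A using Finset.induction_on with
  | empty => simpa using IsPoly.zero s
  | insert i A hi ih =>
    rw [Finset.sum_insert hi]
    exact (hf i (by simp)).add (ih fun j hj => hf j (by simp [hj]))

theorem map_act (hρ : IsGeneralizedAction ρ) (hf : IsPoly ρ s f) (h : H) :
    IsPoly ρ s (fun ω => ρ h (f ω)) := by
  induction hf generalizing h with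
  | act h' a =>
    have := IsPoly.act (ρ := ρ) (h * h') a
    simpa using this
  | lie hf hg ihf ihg =>
    rename_i s t f g
    obtain ⟨k, h', h'', hh⟩ := hρ h
    have : (fun ω => ρ h (⁅f, g⁆ ω)) =
        ∑ i, ⁅(fun ω => ρ (h' i) (f ω)), (fun ω => ρ (h'' i) (g ω))⁆ := by
      funext ω
      simp [hh]
    rw [this]
    exact sum _ _ fun i _ => (ihf _).lie (ihg _)
  | zero s => simpa using! IsPoly.zero s
  | add _ _ ihf ihg => simpa using! (ihf h).add (ihg h)
  | smul c _ ih => simpa using! (ih h).smul c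

/-- Substituting a polynomial value for one of the arguments. -/
theorem subst (hρ : IsGeneralizedAction ρ) {m : Ω → L} (hf : IsPoly ρ (m ::ₘ s) f)
    (hm : IsPoly ρ t m) : IsPoly ρ (t + s) f := by
  generalize hu : m ::ₘ s = u at hf
  induction hf generalizing s with
  | act h a =>
    obtain ⟨rfl, rfl⟩ : m = a ∧ s = 0 := by
      have : m ::ₘ s = a ::ₘ 0 := hu
      have hc := congrArg Multiset.card this
      have hs : s = 0 := by simpa using hc
      subst hs
      simpa using this
    simpa using hm.map_act hρ h
  | lie hf hg ihf ihg =>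
    rename_i s₁ s₂ f g
    have hmem : m ∈ s₁ + s₂ := hu ▸ Multiset.mem_cons_self m s
    rcases Multiset.mem_add.1 hmem with h1 | h2
    · obtain ⟨s', rfl⟩ := Multiset.exists_cons_of_mem h1
      rw [Multiset.cons_add, Multiset.cons_inj_right] at hu
      subst hu
      rw [← add_assoc]
      exact (ihf rfl).lie hg
    · obtain ⟨s', rfl⟩ := Multiset.exists_cons_of_mem h2
      rw [Multiset.add_cons, Multiset.cons_inj_right] at hu
      subst hu
      rw [add_left_comm]
      exact hf.lie (ihg rfl)
  | zero s => exact IsPoly.zero _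
  | add _ _ ihf ihg => exact (ihf hu).add (ihg hu)
  | smul c _ ih => exact (ih hu).smul c

end IsPoly

/-! ### Reduction to left-normed commutators -/

theorem leftNormed_concat {A : Type*} [LieRing A] {l : List A} (hl : l ≠ []) (a : A) :
    leftNormed (l ++ [a]) = ⁅leftNormed l, a⁆ := by
  cases l with
  | nil => exact absurd rfl hl
  | cons b l => simp [leftNormed]

/-- The span of the left-normed commutators in which the arguments are the members of `s` acted
on by elements of `H`. -/
def leftNormedSpan (ρ : H →ₐ[F] Module.End F L) {Ω : Type*} (s : Multiset (Ω → L)) :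
    Submodule F (Ω → L) :=
  Submodule.span F {f | ∃ l : List (H × (Ω → L)), (l.map Prod.snd : Multiset (Ω → L)) = s ∧
    f = leftNormed (l.map fun p ω => ρ p.1 (p.2 ω))}

section leftNormedSpan

variable {ρ : H →ₐ[F] Module.End F L} {Ω : Type*} {s t : Multiset (Ω → L)} {f g : Ω → L}

theorem lie_act_mem_leftNormedSpan (hf : f ∈ leftNormedSpan ρ s) (h : H) (a : Ω → L) :
    ⁅f, (fun ω => ρ h (a ω) : Ω → L)⁆ ∈ leftNormedSpan ρ (s + {a}) := by
  unfold leftNormedSpan at hf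
  induction hf using Submodule.span_induction with
  | mem f hf =>
    obtain ⟨l, hs, rfl⟩ := hf
    rcases eq_or_ne l [] with rfl | hl
    · simp [leftNormed]
    · refine Submodule.subset_span ⟨l ++ [(h, a)], ?_, ?_⟩
      · simp [← Multiset.coe_add, ← Multiset.coe_singleton, ← hs]
      · rw [List.map_append, List.map_cons, List.map_nil, leftNormed_concat (by simpa using hl)]
  | zero => simp
  | add x y _ _ hx hy =>
    rw [add_lie]
    exact add_mem hx hy
  | smul c x _ hx =>
    rw [smul_lie]
    exact Submodule.smul_mem _ c hx

/-- Induction on the second commutator, by the Jacobi identity [f, [m, p]] = [[f, m], p] - [[f, p],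
m]. -/
theorem lie_leftNormed_mem_leftNormedSpan (l : List (H × (Ω → L))) :
    ∀ (s : Multiset (Ω → L)) (f : Ω → L), f ∈ leftNormedSpan ρ s →
      ⁅f, leftNormed (l.map fun p ω => ρ p.1 (p.2 ω))⁆ ∈
        leftNormedSpan ρ (s + (l.map Prod.snd : Multiset (Ω → L))) := by
  induction l using List.reverseRecOn with
  | nil => intro s f _; simp [leftNormed]
  | append_singleton l p ih =>
    intro s f hf
    rcases eq_or_ne l [] with rfl | hl
    · simpa [leftNormed] using! lie_act_mem_leftNormedSpan hf p.1 p.2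
    · rw [List.map_append (f := fun (p : H × (Ω → L)) ω => ρ p.1 (p.2 ω)), List.map_cons,
        List.map_nil, leftNormed_concat (by simpa using hl), leibniz_lie,
        ← lie_skew (leftNormed _) ⁅f, _⁆]
      have e : (s + ((l ++ [p]).map Prod.snd : Multiset (Ω → L))) =
          s + (l.map Prod.snd : Multiset (Ω → L)) + {p.2} := by
        simp [← Multiset.coe_add, ← Multiset.coe_singleton, add_assoc]
      refine add_mem ?_ (neg_mem ?_)
      · rw [e]
        exact lie_act_mem_leftNormedSpan (ih s f hf) p.1 p.2
      · rw [e, add_right_comm]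
        exact ih _ _ (lie_act_mem_leftNormedSpan hf p.1 p.2)

theorem IsPoly.mem_leftNormedSpan (hf : IsPoly ρ s f) : f ∈ leftNormedSpan ρ s := by
  induction hf with
  | act h a => exact Submodule.subset_span ⟨[(h, a)], by simp, by simp [leftNormed]⟩
  | lie _ _ ihf ihg =>
    rename_i s t f g _ _
    refine Submodule.span_induction
      (p := fun g _ => ⁅f, g⁆ ∈ leftNormedSpan ρ (s + t)) ?_ ?_ ?_ ?_ ihg
    · rintro _ ⟨l, hs, hg⟩
      rw [hg, ← hs]
      exact lie_leftNormed_mem_leftNormedSpan l s f ihf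
    · simp
    · intro x y _ _ hx hy
      rw [lie_add]
      exact add_mem hx hy
    · intro c x _ hx
      rw [lie_smul]
      exact Submodule.smul_mem _ c hx
  | zero s => exact zero_mem _
  | add _ _ ihf ihg => exact add_mem ihf ihg
  | smul c _ ih => exact Submodule.smul_mem _ c ih

end leftNormedSpan

/-! ### Evaluations and bounds on the codimension -/

/-- Two finite families with the same multiset of values differ by a permutation. -/
theorem exists_perm_of_map_univ_eq {ι α : Type*} [Fintype ι] {f g : ι → α}
    (h : (Finset.univ : Finset ι).val.map f = (Finset.univ : Finset ι).val.map g) :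
    ∃ σ : Equiv.Perm ι, ∀ i, f i = g (σ i) := by
  classical
  have hcard : ∀ y, Nonempty ({x // f x = y} ≃ {x // g x = y}) := by
    intro y
    rw [← Fintype.card_eq]
    have := congrArg (Multiset.count y) h
    rw [Multiset.count_map, Multiset.count_map] at this
    rw [Fintype.card_subtype, Fintype.card_subtype]
    simpa [Finset.card_def, Finset.filter_val, eq_comm] using this
  let e := fun y => (hcard y).some
  refine ⟨(Equiv.sigmaFiberEquiv f).symm.trans
    ((Equiv.sigmaCongrRight e).trans (Equiv.sigmaFiberEquiv g)), fun i => ?_⟩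
  exact ((e (f i) ⟨i, rfl⟩).2).symm

/-- The evaluation of `H`-polynomials at a sequence of functions with values in `L`. -/
def evalFun (ρ : H →ₐ[F] Module.End F L) {Ω : Type*} (a : ℕ → Ω → L) :
    FreeHLie F H →ₗ[F] (Ω → L) :=
  LinearMap.pi fun ω => (eval ρ fun i => a i ω : FreeHLie F H →ₗ[F] L)

theorem evalFun_apply (ρ : H →ₐ[F] Module.End F L) {Ω : Type*} (a : ℕ → Ω → L)
    (f : FreeHLie F H) (ω : Ω) : evalFun ρ a f ω = eval ρ (fun i => a i ω) f := rfl

theorem mem_identities {ρ : H →ₐ[F] Module.End F L} {f : FreeHLie F H} :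
    f ∈ identities ρ ↔ ∀ l : ℕ → L, eval ρ l f = 0 := by
  simp [identities, LieSubmodule.mem_iInf]

theorem evalFun_eq_zero_of_mem_identities (ρ : H →ₐ[F] Module.End F L) {Ω : Type*}
    (a : ℕ → Ω → L) {f : FreeHLie F H} (hf : f ∈ (identities ρ).toSubmodule) :
    evalFun ρ a f = 0 := by
  funext ω
  rw [evalFun_apply]
  exact mem_identities.1 hf _

theorem map_leftNormed {A B : Type*} [LieRing A] [LieRing B] (φ : A → B) (h0 : φ 0 = 0)
    (hφ : ∀ x y, φ ⁅x, y⁆ = ⁅φ x, φ y⁆) (l : List A) :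
    φ (leftNormed l) = leftNormed (l.map φ) := by
  induction l using List.reverseRecOn with
  | nil => simpa [leftNormed] using h0
  | append_singleton l a ih =>
    rcases eq_or_ne l [] with rfl | hl
    · simp [leftNormed]
    · rw [leftNormed_concat hl, hφ, ih, List.map_append, List.map_singleton,
        leftNormed_concat (by simpa using hl)]

theorem evalFun_leftNormed (ρ : H →ₐ[F] Module.End F L) {Ω : Type*} (a : ℕ → Ω → L) (n : ℕ)
    (i : Fin n → ℕ) (h : Fin n → H) :
    evalFun ρ a (leftNormed (List.ofFn fun j => var F (i j) (h j))) =
      leftNormed (List.ofFn fun j ω => ρ (h j) (a (i j) ω)) := by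
  rw [map_leftNormed (evalFun ρ a) (map_zero _), List.map_ofFn]
  · congr 2
    funext j ω
    simp [evalFun_apply, eval_var]
  · intro x y
    funext ω
    simp [evalFun_apply]

theorem leftNormedSpan_le_map_evalFun (ρ : H →ₐ[F] Module.End F L) {Ω : Type*} (n : ℕ)
    (a : ℕ → Ω → L) :
    leftNormedSpan ρ (List.ofFn fun i : Fin n => a i : Multiset (Ω → L)) ≤
      (multilinear F H n).map (evalFun ρ a) := by
  unfold leftNormedSpan
  rw [Submodule.span_le]
  rintro f ⟨l, hl, rfl⟩
  obtain rfl : l.length = n := by simpa using congrArg Multiset.card hl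
  obtain ⟨σ, hσ⟩ := exists_perm_of_map_univ_eq (ι := Fin l.length)
    (f := fun j => (l.get j).2) (g := fun i => a i) (by
      rw [Fin.univ_val_map, Fin.univ_val_map, ← hl]
      congr 1
      apply List.ext_getElem <;> simp)
  refine ⟨leftNormed (List.ofFn fun j => var F (σ j : ℕ) (l.get j).1),
    Submodule.subset_span ⟨(σ, fun j => (l.get j).1), rfl⟩, ?_⟩
  rw [evalFun_leftNormed]
  congr 1
  apply List.ext_getElem
  · simp
  · intro i h1 h2
    have := hσ ⟨i, by simpa using h1⟩
    simp only [List.get_eq_getElem] at this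
    simp [← this]

theorem append_singleton_set_length {α : Type*} (l : List α) (a b : α) :
    (l ++ [a]).set l.length b = l ++ [b] := by
  simp

theorem leftNormed_set_add {A : Type*} [LieRing A] (l : List A) (i : ℕ) (hi : i < l.length)
    (x y : A) : leftNormed (l.set i (x + y)) = leftNormed (l.set i x) + leftNormed (l.set i y) := by
  induction l using List.reverseRecOn generalizing i with
  | nil => simp at hi
  | append_singleton l a ih =>
    rcases eq_or_ne l [] with rfl | hl
    · obtain rfl : i = 0 := by simpa using hi
      simp [leftNormed]
    have hne : ∀ z, l.set i z ≠ [] := fun z h => hl (by simpa using h)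
    rcases Nat.lt_or_ge i l.length with h | h
    · simp only [List.set_append_left _ _ h]
      rw [leftNormed_concat (hne _), leftNormed_concat (hne _), leftNormed_concat (hne _), ih i h,
        add_lie]
    · obtain rfl : i = l.length := by simp at hi; omega
      simp only [append_singleton_set_length, leftNormed_concat hl, lie_add]

theorem leftNormed_set_smul (l : List L) (i : ℕ) (hi : i < l.length)
    (c : F) (x : L) : leftNormed (l.set i (c • x)) = c • leftNormed (l.set i x) := by
  induction l using List.reverseRecOn generalizing i with
  | nil => simp at hi
  | append_singleton l a ih =>
    rcases eq_or_ne l [] with rfl | hl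
    · obtain rfl : i = 0 := by simpa using hi
      simp [leftNormed]
    have hne : ∀ z, l.set i z ≠ [] := fun z h => hl (by simpa using h)
    rcases Nat.lt_or_ge i l.length with h | h
    · simp only [List.set_append_left _ _ h]
      rw [leftNormed_concat (hne _), leftNormed_concat (hne _), ih i h, smul_lie]
    · obtain rfl : i = l.length := by simp at hi; omega
      simp only [append_singleton_set_length, leftNormed_concat hl, lie_smul]

theorem ofFn_update {α : Type*} {n : ℕ} [DecidableEq (Fin n)] (v : Fin n → α) (i : Fin n)
    (x : α) : List.ofFn (Function.update v i x) = (List.ofFn v).set i x := by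
  apply List.ext_getElem
  · simp
  · intro j h1 h2
    simp only [List.getElem_ofFn, List.getElem_set, Function.update_apply, Fin.ext_iff]
    simp [eq_comm]

variable (F L) in
/-- The left-normed commutator of `n` elements, as a multilinear map. -/
def leftNormedMultilinear (n : ℕ) : MultilinearMap F (fun _ : Fin n => L) L where
  toFun v := leftNormed (List.ofFn v)
  map_update_add' v i x y := by
    simp only [ofFn_update]
    exact leftNormed_set_add _ _ (by simp) _ _
  map_update_smul' v i c x := by
    simp only [ofFn_update]
    exact leftNormed_set_smul _ _ (by simp) _ _

theorem exists_multilinearMap_of_mem_multilinear (ρ : H →ₐ[F] Module.End F L) {n : ℕ}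
    {f : FreeHLie F H} (hf : f ∈ multilinear F H n) :
    ∃ m : MultilinearMap F (fun _ : Fin n => L) L,
      ∀ l : ℕ → L, eval ρ l f = m fun i => l i := by
  unfold multilinear at hf
  induction hf using Submodule.span_induction with
  | mem f hf =>
    obtain ⟨⟨σ, h⟩, rfl⟩ := hf
    refine ⟨((leftNormedMultilinear F L n).compLinearMap fun j => ρ (h j)).domDomCongr σ,
      fun l => ?_⟩
    have := congrFun (evalFun_leftNormed ρ (fun i (_ : Unit) => l i) n (fun j => σ j) h) ()
    rw [evalFun_apply] at this
    refine this.trans ?_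
    rw [map_leftNormed (fun f : Unit → L => f ()) rfl (fun _ _ => rfl), List.map_ofFn]
    rfl
  | zero => exact ⟨0, fun l => by simp⟩
  | add x y _ _ hx hy =>
    obtain ⟨m, hm⟩ := hx
    obtain ⟨m', hm'⟩ := hy
    exact ⟨m + m', fun l => by simp [hm, hm']⟩
  | smul c x _ hx =>
    obtain ⟨m, hm⟩ := hx
    exact ⟨c • m, fun l => by simp [hm]⟩

/-- The evaluation of the multilinear part of the relatively free algebra at functions. -/
def relEval (ρ : H →ₐ[F] Module.End F L) {Ω : Type*} (n : ℕ) (a : ℕ → Ω → L) :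
    ((multilinear F H n).map (identities ρ).toSubmodule.mkQ) →ₗ[F] (Ω → L) :=
  ((identities ρ).toSubmodule.liftQ (evalFun ρ a) fun _ hf =>
    evalFun_eq_zero_of_mem_identities ρ a hf).domRestrict _

theorem range_relEval (ρ : H →ₐ[F] Module.End F L) {Ω : Type*} (n : ℕ) (a : ℕ → Ω → L) :
    LinearMap.range (relEval ρ n a) = (multilinear F H n).map (evalFun ρ a) := by
  rw [relEval, LinearMap.range_domRestrict, ← Submodule.map_comp]
  rfl

/-- The points of the domain are the n-tuples of basis vectors, and the i-th variable is the i-th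
coordinate. A multilinear map vanishing at all of them is zero. The value 0 for i ≥ n plays no role.
-/
theorem relEval_basis_injective (ρ : H →ₐ[F] Module.End F L) {ι : Type*}
    (b : Module.Basis ι F L) (n : ℕ) :
    Function.Injective (relEval ρ n fun i (ω : Fin n → ι) =>
      if hi : i < n then b (ω ⟨i, hi⟩) else 0) := by
  rw [← LinearMap.ker_eq_bot, LinearMap.ker_eq_bot']
  rintro ⟨_, f, hf, rfl⟩ h0
  replace h0 : evalFun ρ (fun i (ω : Fin n → ι) => if hi : i < n then b (ω ⟨i, hi⟩) else 0) f
    = 0 := h0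
  obtain ⟨m, hm⟩ := exists_multilinearMap_of_mem_multilinear ρ hf
  have hm0 : m = 0 := by
    refine Module.Basis.ext_multilinear (fun _ => b) fun v => ?_
    have := congrFun h0 v
    rw [evalFun_apply, hm] at this
    simpa using this
  rw [Subtype.ext_iff]
  refine (Submodule.Quotient.mk_eq_zero _).2 ?_
  exact mem_identities.2 fun l => by simp [hm, hm0]

theorem finite_map_multilinear [FiniteDimensional F L] (ρ : H →ₐ[F] Module.End F L) (n : ℕ) :
    Module.Finite F ((multilinear F H n).map (identities ρ).toSubmodule.mkQ) :=
  Module.Finite.of_injective _ (relEval_basis_injective ρ (Module.finBasis F L) n)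

theorem codim_le [FiniteDimensional F L] (ρ : H →ₐ[F] Module.End F L) (n : ℕ) :
    codim ρ n ≤ Module.finrank F L ^ (n + 1) := by
  refine (LinearMap.finrank_le_finrank_of_injective
    (relEval_basis_injective ρ (Module.finBasis F L) n)).trans_eq ?_
  rw [Module.finrank_pi_fintype]
  simp [pow_succ]

/-- Every space of values of multilinear `H`-polynomials bounds the codimension from below. -/
theorem finrank_leftNormedSpan_le_codim [FiniteDimensional F L] (ρ : H →ₐ[F] Module.End F L)
    {Ω : Type*} [Finite Ω] (s : Multiset (Ω → L)) :
    Module.finrank F (leftNormedSpan ρ s) ≤ codim ρ s.card := by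
  have := finite_map_multilinear ρ s.card
  -- The default 0 is never reached: only the first `s.card` variables occur.
  let a : ℕ → Ω → L := fun i => s.toList.getD i 0
  have hs : (List.ofFn fun i : Fin s.card => a i : Multiset (Ω → L)) = s := by
    conv_rhs => rw [← s.coe_toList]
    congr 1
    apply List.ext_getElem
    · simp
    · intro i h1 h2
      simp [a]
  calc Module.finrank F (leftNormedSpan ρ s)
      ≤ Module.finrank F (LinearMap.range (relEval ρ s.card a)) := by
        refine Submodule.finrank_mono ?_
        rw [range_relEval]
        conv_lhs => rw [← hs]
        exact leftNormedSpan_le_map_evalFun ρ s.card a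
    _ ≤ codim ρ s.card := LinearMap.finrank_range_le _

/-! ### Schur's lemma and density -/

theorem IsHSimple.nontrivial {ρ : H →ₐ[F] Module.End F L} (hs : IsHSimple ρ) : Nontrivial L := by
  by_contra h
  rw [not_nontrivial_iff_subsingleton] at h
  exact hs.1 ⟨fun _ _ => Subsingleton.elim _ _⟩

/-- Schur's lemma: an eigenspace of φ is a nonzero H-invariant ideal, hence everything. -/
theorem IsHSimple.isHCentral [IsAlgClosed F] [FiniteDimensional F L]
    {ρ : H →ₐ[F] Module.End F L} (hs : IsHSimple ρ) : IsHCentral ρ := by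
  intro φ hφ hφρ
  have := hs.nontrivial
  obtain ⟨c, hc⟩ := Module.End.exists_eigenvalue φ
  let I : LieIdeal F L :=
    { φ.eigenspace c with
      lie_mem := fun {x m} hm => by
        have hm' : φ m = c • m := Module.End.mem_eigenspace_iff.1 hm
        refine Module.End.mem_eigenspace_iff.2 ?_
        rw [hφ, hm', lie_smul] }
  have hI : ∀ x, x ∈ I ↔ φ x = c • x := fun x => Module.End.mem_eigenspace_iff
  rcases hs.2 I (fun h x hx => by rw [hI] at hx ⊢; rw [hφρ, hx, map_smul]) with h | h
  · obtain ⟨v, hv⟩ := hc.exists_hasEigenvector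
    refine absurd ?_ hv.2
    have : v ∈ I := (hI v).2 hv.apply_eq_smul
    rwa [h, LieSubmodule.mem_bot] at this
  · exact ⟨c, fun x => (hI x).1 (h ▸ LieSubmodule.mem_top x)⟩

theorem map_univ_val_comp_equiv {ι κ α : Type*} [Fintype ι] [Fintype κ] (e : ι ≃ κ) (a : κ → α) :
    (Finset.univ : Finset ι).val.map (fun i => a (e i)) =
      (Finset.univ : Finset κ).val.map a := by
  rw [← Multiset.map_univ_val_equiv e, Multiset.map_map]
  rfl

/-- The operators `ad x` and `ρ h`. -/
def generators (ρ : H →ₐ[F] Module.End F L) : Set (Module.End F L) :=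
  Set.range (LieAlgebra.ad F L) ∪ Set.range ρ

theorem ad_mem_generators (ρ : H →ₐ[F] Module.End F L) (x : L) :
    LieAlgebra.ad F L x ∈ generators ρ := Or.inl ⟨x, rfl⟩

theorem act_mem_generators (ρ : H →ₐ[F] Module.End F L) (h : H) :
    ρ h ∈ generators ρ := Or.inr ⟨h, rfl⟩

theorem isSimpleModule_adjoin {ρ : H →ₐ[F] Module.End F L} (hs : IsHSimple ρ) :
    IsSimpleModule (Algebra.adjoin F (generators ρ)) L := by
  have := hs.nontrivial
  rw [isSimpleModule_iff]
  refine { eq_bot_or_eq_top := fun N => ?_ }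
  have hsmul : ∀ g (hg : g ∈ Algebra.adjoin F (generators ρ)), ∀ x ∈ N, g x ∈ N :=
    fun g hg x hx => N.smul_mem ⟨g, hg⟩ hx
  let I : LieIdeal F L :=
    { carrier := N
      add_mem' := N.add_mem
      zero_mem' := N.zero_mem
      smul_mem' := fun c x hx => by
        simpa using hsmul _ (Subalgebra.algebraMap_mem _ c) x hx
      lie_mem := fun {x m} hm =>
        hsmul _ (Algebra.subset_adjoin (ad_mem_generators ρ x)) m hm }
  have hI : ∀ x, x ∈ I ↔ x ∈ N := fun x => Iff.rfl
  rcases hs.2 I (fun h x hx => hsmul _ (Algebra.subset_adjoin (act_mem_generators ρ h)) x hx)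
    with h | h
  · refine Or.inl (eq_bot_iff.2 fun x hx => ?_)
    rw [← hI, h, LieSubmodule.mem_bot] at hx
    simpa using hx
  · refine Or.inr (eq_top_iff.2 fun x _ => ?_)
    rw [← hI, h]
    exact LieSubmodule.mem_top x

/-- The operators `ad x` and `ρ h` generate the full endomorphism algebra. -/
theorem adjoin_generators_eq_top [FiniteDimensional F L] {ρ : H →ₐ[F] Module.End F L}
    (hs : IsHSimple ρ) (hc : IsHCentral ρ) : Algebra.adjoin F (generators ρ) = ⊤ := by
  classical
  have := isSimpleModule_adjoin hs
  set A := Algebra.adjoin F (generators ρ) with hA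
  have hscalar : ∀ φ : Module.End A L, ∃ c : F, ∀ x, φ x = c • x := by
    intro φ
    have hφ : ∀ g (hg : g ∈ A) x, φ (g x) = g (φ x) := fun g hg x => φ.map_smul ⟨g, hg⟩ x
    let φ' : Module.End F L :=
      { toFun := φ
        map_add' := φ.map_add
        map_smul' := fun c x => by
          simp }
    exact hc φ' (fun x y => hφ _ (Algebra.subset_adjoin (ad_mem_generators ρ x)) y)
      (fun h x => hφ _ (Algebra.subset_adjoin (act_mem_generators ρ h)) x)
  rw [eq_top_iff]
  intro T _
  -- The commutant consists of scalars, so every F-linear T lies in the bicommutant; density on a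
  -- basis puts it in A.
  let f : Module.End (Module.End A L) L :=
    { toFun := T
      map_add' := T.map_add
      map_smul' := fun φ x => by
        obtain ⟨c, hc⟩ := hscalar φ
        simp [hc] }
  let b := Module.finBasis F L
  obtain ⟨r, hr⟩ := jacobson_density f (Finset.univ.image b)
  have : T = r.1 := b.ext fun i => hr (b i) (by simp)
  rw [this]
  exact r.2

theorem span_closure_generators_eq_top [FiniteDimensional F L] {ρ : H →ₐ[F] Module.End F L}
    (hs : IsHSimple ρ) (hc : IsHCentral ρ) :
    Submodule.span F (Submonoid.closure (generators ρ) : Set (Module.End F L)) = ⊤ := by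
  rw [← Algebra.adjoin_eq_span, adjoin_generators_eq_top hs hc, Algebra.top_toSubmodule]

/-! ### A polynomial with a determinant as its value -/

/-- A multiset of elements, regarded as constant functions. -/
def consts {L : Type*} (Ω : Type*) (c : Multiset L) : Multiset (Ω → L) := c.map fun l _ => l

@[simp]
theorem consts_zero {L : Type*} (Ω : Type*) : consts Ω (0 : Multiset L) = 0 := rfl

@[simp]
theorem consts_add {L : Type*} (Ω : Type*) (c c' : Multiset L) :
    consts Ω (c + c') = consts Ω c + consts Ω c' := Multiset.map_add _ _ _

@[simp]
theorem consts_singleton {L : Type*} (Ω : Type*) (x : L) : consts Ω {x} = {fun _ => x} := rfl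

@[simp]
theorem card_consts {L : Type*} (Ω : Type*) (c : Multiset L) : (consts Ω c).card = c.card :=
  Multiset.card_map _ _

/-- Applying a product of generators to a polynomial value only uses additional constants. -/
theorem exists_consts_isPoly {ρ : H →ₐ[F] Module.End F L} (hρ : IsGeneralizedAction ρ)
    {A : Module.End F L} (hA : A ∈ Submonoid.closure (generators ρ)) :
    ∃ c : Multiset L, ∀ (Ω : Type) (s : Multiset (Ω → L)) (f : Ω → L), IsPoly ρ s f →
      IsPoly ρ (s + consts Ω c) (fun ω => A (f ω)) := by
  induction hA using Submonoid.closure_induction with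
  | mem A hA =>
    rcases hA with ⟨x, rfl⟩ | ⟨h, rfl⟩
    · refine ⟨{x}, fun Ω s f hf => ?_⟩
      rw [add_comm, consts_singleton]
      exact (IsPoly.of_self _).lie hf
    · exact ⟨0, fun Ω s f hf => by simpa using hf.map_act hρ h⟩
  | one => exact ⟨0, fun Ω s f hf => by simpa using hf⟩
  | mul A B _ _ hA hB =>
    obtain ⟨c, hc⟩ := hA
    obtain ⟨c', hc'⟩ := hB
    refine ⟨c' + c, fun Ω s f hf => ?_⟩
    rw [consts_add, ← add_assoc]
    exact hc Ω _ _ (hc' Ω _ _ hf)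

/-- The multilinear map `x ↦ ad (A₀ x₀) ⋯ ad (A_{k-1} x_{k-1}) z`. -/
def adProd {k : ℕ} (A : Fin k → Module.End F L) (z : L) :
    MultilinearMap F (fun _ : Fin k => L) L :=
  (LinearMap.applyₗ z : Module.End F L →ₗ[F] L).compMultilinearMap
    ((MultilinearMap.mkPiAlgebraFin F k (Module.End F L)).compLinearMap
      fun i => (LieAlgebra.ad F L : L →ₗ[F] Module.End F L) ∘ₗ A i)

theorem adProd_apply {k : ℕ} (A : Fin k → Module.End F L) (z : L) (x : Fin k → L) :
    adProd A z x = (List.ofFn fun i => LieAlgebra.ad F L (A i (x i))).prod z := by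
  simp [adProd]

theorem exists_consts_isPoly_adProd {ρ : H →ₐ[F] Module.End F L} (hρ : IsGeneralizedAction ρ)
    {k : ℕ} {A : Fin k → Module.End F L} (hA : ∀ i, A i ∈ Submonoid.closure (generators ρ))
    (z : L) :
    ∃ c : Multiset L, ∀ (Ω : Type) (a : Fin k → Ω → L),
      IsPoly ρ (Finset.univ.val.map a + consts Ω c) (fun ω => adProd A z fun i => a i ω) := by
  choose c hc using fun i => exists_consts_isPoly hρ (hA i)
  have key : ∀ (l : List (Fin k)) (Ω : Type) (a : Fin k → Ω → L),
      IsPoly ρ ((l.map a : Multiset (Ω → L)) + consts Ω ((l.map c).sum + {z}))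
        (fun ω => (l.map fun i => LieAlgebra.ad F L (A i (a i ω))).prod z) := by
    intro l Ω a
    induction l with
    | nil => simpa using IsPoly.of_self (ρ := ρ) (fun _ : Ω => z)
    | cons i l ih =>
      have := (hc i Ω _ _ (IsPoly.of_self (a i))).lie ih
      convert this using 1
      simp only [List.map_cons, List.sum_cons, consts_add, ← Multiset.cons_coe,
        ← Multiset.singleton_add]
      · abel
      · rfl
  refine ⟨((List.finRange k).map c).sum + {z}, fun Ω a => ?_⟩
  have := key (List.finRange k) Ω a
  simp only [adProd_apply, List.ofFn_eq_map]
  rwa [← Multiset.map_coe] at this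

theorem exists_adProd_ne_zero (hL : ∀ z : L, z ≠ 0 → ∃ w : L, ⁅w, z⁆ ≠ 0) {z : L} (hz : z ≠ 0)
    (k : ℕ) : ∃ w : Fin k → L, (List.ofFn fun i => LieAlgebra.ad F L (w i)).prod z ≠ 0 := by
  induction k with
  | zero => exact ⟨Fin.elim0, by simpa using hz⟩
  | succ k ih =>
    obtain ⟨w, hw⟩ := ih
    obtain ⟨v, hv⟩ := hL _ hw
    exact ⟨Fin.cons v w, by simpa using hv⟩

/-- The alternatization at b is multilinear in A, and products of generators span End L; were it
zero on all of these, it would vanish for arbitrary A. For the rank-one operators A_i = b_i^*(·) w_i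
only the identity permutation survives, leaving ad w_0 ⋯ ad w_{k-1} z, which is nonzero for suitable
w. -/
theorem alternatization_adProd_ne_zero [FiniteDimensional F L] {ρ : H →ₐ[F] Module.End F L}
    (hs : IsHSimple ρ) (hc : IsHCentral ρ) (hL : ∀ z : L, z ≠ 0 → ∃ w : L, ⁅w, z⁆ ≠ 0)
    {z : L} (hz : z ≠ 0) {k : ℕ} (b : Module.Basis (Fin k) F L) :
    ∃ A : Fin k → Module.End F L, (∀ i, A i ∈ Submonoid.closure (generators ρ)) ∧
      MultilinearMap.alternatization (adProd A z) b ≠ 0 := by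
  by_contra! hcon
  let N : MultilinearMap F (fun _ : Fin k => Module.End F L) L :=
    ∑ σ : Equiv.Perm (Fin k), Equiv.Perm.sign σ •
      (LinearMap.applyₗ z : Module.End F L →ₗ[F] L).compMultilinearMap
        ((MultilinearMap.mkPiAlgebraFin F k (Module.End F L)).compLinearMap
          fun i => (LieAlgebra.ad F L : L →ₗ[F] Module.End F L) ∘ₗ
            (LinearMap.applyₗ (b (σ i)) : Module.End F L →ₗ[F] L))
  have hN : ∀ A, N A = MultilinearMap.alternatization (adProd A z) b := by
    intro A
    rw [MultilinearMap.alternatization_apply]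
    simp [N, adProd_apply]
  let B := Module.Basis.ofSpan (span_closure_generators_eq_top hs hc).ge
  have hN0 : N = 0 := by
    refine Module.Basis.ext_multilinear (fun _ => B) fun v => ?_
    rw [hN, hcon]
    · rfl
    · exact fun i => Module.Basis.ofSpan_subset _ ⟨v i, rfl⟩
  obtain ⟨w, hw⟩ := exists_adProd_ne_zero (F := F) hL hz k
  refine hw ?_
  have h := congrArg (fun m => m fun i => (b.coord i).smulRight (w i)) hN0
  simp only [N, sum_apply, zero_apply] at h
  rw [Finset.sum_eq_single 1] at h
  · simpa using h
  · intro σ _ hσ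
    obtain ⟨i, hi⟩ : ∃ i, σ i ≠ i := by
      by_contra! h
      exact hσ (Equiv.ext h)
    have h0 : MultilinearMap.mkPiAlgebraFin F k (Module.End F L)
        (fun j => LieAlgebra.ad F L ((b.coord j).smulRight (w j) (b (σ j)))) = 0 :=
      MultilinearMap.map_coord_zero _ i (by simp [hi])
    rw [smul_apply]
    refine (congrArg (fun T : Module.End F L => Equiv.Perm.sign σ • T z) h0).trans ?_
    simp
  · simp

theorem alternating_eq_det_smul {k : ℕ} (b : Module.Basis (Fin k) F L) (f : L [⋀^Fin k]→ₗ[F] L)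
    (x : Fin k → L) : f x = b.det x • f b := by
  have : f = (LinearMap.toSpanSingleton F L (f b)).compAlternatingMap b.det := by
    refine Module.Basis.ext_alternating b fun v hv => ?_
    have e : (fun i => b (v i)) = b ∘ Equiv.ofBijective v (Finite.injective_iff_bijective.1 hv) :=
      rfl
    rw [e, AlternatingMap.map_perm, AlternatingMap.map_perm]
    simp [b.det_self]
  conv_lhs => rw [this]
  simp

/-- There are nonzero values of polynomials of the form `det (a₁, …, a_d) • g`, with any
sufficiently large number of constants. -/
theorem exists_isPoly_det_smul [FiniteDimensional F L] {ρ : H →ₐ[F] Module.End F L}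
    (hρ : IsGeneralizedAction ρ)
    (hs : IsHSimple ρ) (hc : IsHCentral ρ) (hL : ∀ z : L, z ≠ 0 → ∃ w : L, ⁅w, z⁆ ≠ 0)
    {k : ℕ} (b : Module.Basis (Fin k) F L) :
    ∃ q : ℕ, ∀ n ≥ q, ∃ c : Multiset L, c.card = n ∧ ∃ g : L, g ≠ 0 ∧
      ∀ (Ω : Type) (a : Fin k → Ω → L),
        IsPoly ρ (Finset.univ.val.map a + consts Ω c) (fun ω => b.det (fun i => a i ω) • g) := by
  have := hs.nontrivial
  obtain ⟨z, hz⟩ := exists_ne (0 : L)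
  obtain ⟨A, hA, hne⟩ := alternatization_adProd_ne_zero hs hc hL hz b
  obtain ⟨c, hc⟩ := exists_consts_isPoly_adProd hρ hA z
  refine ⟨c.card, fun n hn => ?_⟩
  induction n, hn using Nat.le_induction with
  | base =>
    refine ⟨c, rfl, _, hne, fun Ω a => ?_⟩
    have e : (fun ω => b.det (fun i => a i ω) • MultilinearMap.alternatization (adProd A z) b) =
        ∑ σ : Equiv.Perm (Fin k), (Equiv.Perm.sign σ : ℤ) •
          (fun ω => adProd A z fun i => a (σ i) ω) := by
      funext ω
      rw [← alternating_eq_det_smul, MultilinearMap.alternatization_apply]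
      simp [Finset.sum_apply, Units.smul_def]
    rw [e]
    -- Permuting the arguments changes neither their multiset nor the constants, so the terms can be
    -- added.
    refine IsPoly.sum _ _ fun σ _ => ?_
    have h1 := (hc Ω fun i => a (σ i)).smul ((Equiv.Perm.sign σ : ℤ) : F)
    rw [map_univ_val_comp_equiv] at h1
    simpa [Int.cast_smul_eq_zsmul] using h1
  | succ n _ ih =>
    obtain ⟨c, rfl, g, hg, h⟩ := ih
    -- Bracketing with w uses up one more constant and keeps the vector nonzero.
    obtain ⟨w, hw⟩ := hL g hg
    refine ⟨c + {w}, by simp, ⁅w, g⁆, hw, fun Ω a => ?_⟩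
    have := (IsPoly.of_self (ρ := ρ) (fun _ : Ω => w)).lie (h Ω a)
    rw [consts_add, ← add_assoc, add_comm, consts_singleton]
    convert this using 1
    funext ω
    simp

/-! ### Further determinants from the Killing form -/

theorem exists_lie_ne_zero [CharZero F] [FiniteDimensional F L]
    (hss : LieAlgebra.IsSemisimple F L) (z : L) (hz : z ≠ 0) : ∃ w : L, ⁅w, z⁆ ≠ 0 := by
  by_contra! h
  refine hz ?_
  have : z ∈ LieAlgebra.center F L := fun w => h w
  rwa [LieAlgebra.center_eq_bot, LieSubmodule.mem_bot] at this

theorem det_killingForm_ne_zero [CharZero F] [FiniteDimensional F L]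
    (hss : LieAlgebra.IsSemisimple F L) {k : ℕ} (b : Module.Basis (Fin k) F L) :
    (LinearMap.toMatrix₂ b b (killingForm F L)).det ≠ 0 :=
  (LinearMap.nondegenerate_iff_det_ne_zero b).1 (LieAlgebra.IsKilling.killingForm_nondegenerate F L)

/-- A linear operator acts on the volume form, as a derivation, by its trace. -/
theorem sum_det_update {V : Type*} [AddCommGroup V] [Module F V] {k : ℕ}
    (b : Module.Basis (Fin k) F V) (φ : Module.End F V) (x : Fin k → V) :
    ∑ i, b.det (Function.update x i (φ (x i))) = LinearMap.trace F V φ * b.det x := by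
  set X := b.toMatrix x with hX
  set Φ := LinearMap.toMatrix b b φ with hΦ
  have hcol : ∀ i, (b.repr (φ (x i)) : Fin k → F) = fun j => (Φ * X) j i := by
    intro i
    funext j
    rw [← LinearMap.toMatrix_mulVec_repr b b φ (x i)]
    rfl
  -- Cramer's rule for the matrix X with its i-th column replaced by that of ΦX.
  have h1 : ∀ i, b.det (Function.update x i (φ (x i))) = (X.adjugate * (Φ * X)) i i := by
    intro i
    rw [Module.Basis.det_apply, Module.Basis.toMatrix_update, hcol, ← Matrix.cramer_apply,
      Matrix.cramer_eq_adjugate_mulVec]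
    rfl
  calc ∑ i, b.det (Function.update x i (φ (x i)))
      = Matrix.trace (X.adjugate * (Φ * X)) := Finset.sum_congr rfl fun i _ => h1 i
    _ = Matrix.trace (Φ * (X * X.adjugate)) := by rw [Matrix.trace_mul_comm, Matrix.mul_assoc]
    _ = _ := by
      rw [Matrix.mul_adjugate, LinearMap.trace_eq_matrix_trace F b, Module.Basis.det_apply]
      simp [mul_comm, hX, hΦ]

theorem det_bilin_eq {V : Type*} [AddCommGroup V] [Module F V] {k : ℕ}
    (b : Module.Basis (Fin k) F V) (B : V →ₗ[F] V →ₗ[F] F) (u v : Fin k → V) :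
    (Matrix.of fun i j => B (u i) (v j)).det =
      (LinearMap.toMatrix₂ b b B).det * (b.det u * b.det v) := by
  have : (Matrix.of fun i j => B (u i) (v j)) =
      (b.toMatrix u).transpose * LinearMap.toMatrix₂ b b B * b.toMatrix v := by
    ext i j
    rw [Matrix.of_apply, _root_.apply_eq_dotProduct_toMatrix₂_mulVec b b, Matrix.mul_assoc]
    rfl
  rw [this, Matrix.det_mul, Matrix.det_mul, Matrix.det_transpose, Module.Basis.det_apply,
    Module.Basis.det_apply]
  ring

/-- `det (a₁, …, a_d) • G` is a polynomial value for all `a`, using `s` in addition to `a`. -/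
def IsDetPoly (ρ : H →ₐ[F] Module.End F L) {k : ℕ} (b : Module.Basis (Fin k) F L) {Ω : Type*}
    (s : Multiset (Ω → L)) (G : Ω → L) : Prop :=
  ∀ a : Fin k → Ω → L,
    IsPoly ρ (Finset.univ.val.map a + s) (fun ω => b.det (fun i => a i ω) • G ω)

namespace IsDetPoly

variable {ρ : H →ₐ[F] Module.End F L} {k : ℕ} {b : Module.Basis (Fin k) F L} {Ω : Type*}
  {s : Multiset (Ω → L)} {G : Ω → L}

theorem sum {ι : Type*} (A : Finset ι) (f : ι → Ω → L) (hf : ∀ i ∈ A, IsDetPoly ρ b s (f i)) :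
    IsDetPoly ρ b s (∑ i ∈ A, f i) := by
  intro a
  have := IsPoly.sum A _ fun i hi => hf i hi a
  convert this using 1
  funext ω
  simp [Finset.smul_sum]

theorem smul (c : F) (h : IsDetPoly ρ b s G) : IsDetPoly ρ b s (c • G) := by
  intro a
  convert (h a).smul c using 1
  funext ω
  simp [smul_comm c]

/-- The Killing form is the trace of ad u ad v, so `sum_det_update` produces it by substituting [u,
[v, a_i]] for each a_i in turn. -/
theorem killingForm_smul (hρ : IsGeneralizedAction ρ) (h : IsDetPoly ρ b s G) (u v : Ω → L) :
    IsDetPoly ρ b ({u} + {v} + s) (fun ω => killingForm F L (u ω) (v ω) • G ω) := by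
  intro a
  have e : (fun ω => b.det (fun i => a i ω) • killingForm F L (u ω) (v ω) • G ω) =
      ∑ i, fun ω => b.det (fun j => Function.update a i ⁅u, ⁅v, a i⁆⁆ j ω) • G ω := by
    funext ω
    rw [Finset.sum_apply, ← Finset.sum_smul, smul_smul, mul_comm, killingForm_apply_apply,
      ← sum_det_update]
    congr 1
    refine Finset.sum_congr rfl fun i _ => ?_
    congr 1
    funext j
    by_cases hj : j = i
    · subst hj
      simp
    · simp [hj]
  rw [e]
  refine IsPoly.sum _ _ fun i _ => ?_
  have h1 := h (Function.update a i ⁅u, ⁅v, a i⁆⁆)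
  obtain ⟨r, hr⟩ := Multiset.exists_cons_of_mem
    (show i ∈ (Finset.univ : Finset (Fin k)).val from Finset.mem_univ i)
  have hir : i ∉ r := by
    have := (Finset.univ : Finset (Fin k)).nodup
    rw [hr, Multiset.nodup_cons] at this
    exact this.1
  have hmap : r.map (Function.update a i ⁅u, ⁅v, a i⁆⁆) = r.map a :=
    Multiset.map_congr rfl fun j hj => Function.update_of_ne (by rintro rfl; exact hir hj) _ _
  rw [hr, Multiset.map_cons, Function.update_self, hmap, Multiset.cons_add] at h1
  have h2 := h1.subst hρ ((IsPoly.of_self u).lie ((IsPoly.of_self v).lie (IsPoly.of_self (a i))))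
  convert h2 using 1
  rw [hr, Multiset.map_cons, ← Multiset.singleton_add]
  abel

theorem prod_killingForm_smul (hρ : IsGeneralizedAction ρ) (h : IsDetPoly ρ b s G)
    (u v : Fin k → Ω → L) (A : Finset (Fin k)) :
    IsDetPoly ρ b (A.val.map u + A.val.map v + s)
      (fun ω => (∏ i ∈ A, killingForm F L (u i ω) (v i ω)) • G ω) := by
  induction A using Finset.induction_on with
  | empty => simpa using! h
  | insert i A hi ih =>
    have := ih.killingForm_smul hρ (u i) (v i)
    convert this using 1
    · rw [Finset.insert_val_of_notMem hi, Multiset.map_cons, Multiset.map_cons,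
        ← Multiset.singleton_add, ← Multiset.singleton_add]
      abel
    · funext ω
      rw [Finset.prod_insert hi, mul_smul]

/-- The Leibniz expansion of the Gram determinant of u and v has products of Killing forms as terms;
by `det_bilin_eq` it equals D det(u) det(v), and D ≠ 0. -/
theorem det_mul_det_smul [CharZero F] [FiniteDimensional F L]
    (hss : LieAlgebra.IsSemisimple F L) (hρ : IsGeneralizedAction ρ) (h : IsDetPoly ρ b s G)
    (u v : Fin k → Ω → L) :
    IsDetPoly ρ b (Finset.univ.val.map u + Finset.univ.val.map v + s)
      (fun ω => (b.det (fun i => u i ω) * b.det (fun i => v i ω)) • G ω) := by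
  set D := (LinearMap.toMatrix₂ b b (killingForm F L)).det with hD
  have hD0 : D ≠ 0 := det_killingForm_ne_zero hss b
  have e : (fun ω => (b.det (fun i => u i ω) * b.det (fun i => v i ω)) • G ω) =
      D⁻¹ • ∑ σ : Equiv.Perm (Fin k), ((Equiv.Perm.sign σ : ℤ) : F) •
        fun ω => (∏ i, killingForm F L (u (σ i) ω) (v i ω)) • G ω := by
    funext ω
    have := det_bilin_eq b (killingForm F L) (fun i => u i ω) (fun i => v i ω)
    rw [← hD, Matrix.det_apply'] at this
    simp only [Matrix.of_apply] at this
    simp only [Pi.smul_apply, Finset.sum_apply, smul_smul, ← Finset.sum_smul]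
    rw [this, inv_mul_cancel_left₀ hD0]
  rw [e]
  refine smul _ (sum _ _ fun σ _ => smul _ ?_)
  have := h.prod_killingForm_smul hρ (fun i => u (σ i)) v Finset.univ
  rwa [map_univ_val_comp_equiv] at this

theorem prod_det_smul [CharZero F] [FiniteDimensional F L]
    (hss : LieAlgebra.IsSemisimple F L) (hρ : IsGeneralizedAction ρ) (h : IsDetPoly ρ b s G)
    {C : Type*} (u v : C → Fin k → Ω → L) (A : Finset C) :
    IsDetPoly ρ b (∑ c ∈ A, (Finset.univ.val.map (u c) + Finset.univ.val.map (v c)) + s)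
      (fun ω => (∏ c ∈ A, b.det (fun i => u c i ω) * b.det (fun i => v c i ω)) • G ω) := by
  classical
  induction A using Finset.induction_on with
  | empty => simpa using! h
  | insert c A hc ih =>
    have := ih.det_mul_det_smul hss hρ (u c) (v c)
    convert this using 1
    · rw [Finset.sum_insert hc]
      abel
    · funext ω
      rw [Finset.prod_insert hc, mul_smul]

end IsDetPoly

/-- A product of an even number of determinants, times a nonzero element of `L`, is a polynomial
value, with any sufficiently large number of constants. -/
theorem exists_isPoly_prod_det_smul [CharZero F] [FiniteDimensional F L]
    {ρ : H →ₐ[F] Module.End F L} (hρ : IsGeneralizedAction ρ)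
    (hs : IsHSimple ρ) (hc : IsHCentral ρ) (hss : LieAlgebra.IsSemisimple F L)
    {k : ℕ} (b : Module.Basis (Fin k) F L) :
    ∃ q : ℕ, ∀ n ≥ q, ∃ c : Multiset L, c.card = n ∧ ∃ g : L, g ≠ 0 ∧
      ∀ (Ω C : Type) [Fintype C] (u : C × Bool → Fin k → Ω → L),
        IsPoly ρ ((Finset.univ : Finset ((C × Bool) × Fin k)).val.map (fun p => u p.1 p.2) +
          consts Ω c) (fun ω => (∏ c, b.det (fun i => u c i ω)) • g) := by
  obtain ⟨q, hq⟩ := exists_isPoly_det_smul hρ hs hc (exists_lie_ne_zero hss) b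
  refine ⟨q + k, fun n hn => ?_⟩
  obtain ⟨c, hcard, g, hg, h⟩ := hq (n - k) (by omega)
  refine ⟨Finset.univ.val.map b + c, by simp [hcard]; omega, g, hg, fun Ω C _ u => ?_⟩
  have h1 : IsDetPoly ρ b (consts Ω c) (fun _ => g) := fun a => h Ω a
  -- The initial determinant is evaluated at the basis b, where it is 1; this costs k constants.
  have h2 := h1.prod_det_smul hss hρ (fun c => u (c, true)) (fun c => u (c, false)) Finset.univ
    (fun i _ => b i)
  convert h2 using 1
  · have e {ι : Type} [Fintype ι] (a : ι → Ω → L) :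
        (Finset.univ : Finset ι).val.map a = ∑ i, {a i} := by
      conv_lhs => rw [← Multiset.sum_map_singleton (Finset.univ.val.map a), Multiset.map_map]
      rfl
    rw [consts_add, e, Fintype.sum_prod_type, Fintype.sum_prod_type]
    simp only [Fintype.sum_bool, ← e]
    have : consts Ω (Finset.univ.val.map b) = Finset.univ.val.map fun i (_ : Ω) => b i :=
      Multiset.map_map _ _ _
    rw [this]
    abel
  · funext ω
    simp [Fintype.prod_prod_type, b.det_self]

/-! ### Balanced words and their number -/

/-- The words indexed by `Fin d × J` in the alphabet `Fin d` in which every letter occurs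
`|J|` times. -/
def BalancedWord (d : ℕ) (J : Type) : Type :=
  {w : Fin d × J → Fin d // ∀ r, Nonempty (J ≃ {p // w p = r})}

namespace BalancedWord

variable {d : ℕ} {J : Type}

instance [Finite J] : Finite (BalancedWord d J) :=
  inferInstanceAs (Finite {w : Fin d × J → Fin d // ∀ r, Nonempty (J ≃ {p // w p = r})})

instance : Nonempty (BalancedWord d J) :=
  ⟨⟨Prod.fst, fun r => ⟨⟨fun j => ⟨(r, j), rfl⟩, fun p => p.1.2, fun _ => rfl,
    fun ⟨⟨_, _⟩, h⟩ => Subtype.ext (Prod.ext h.symm rfl)⟩⟩⟩⟩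

/-- An enumeration of the occurrences of the letters: `occ w (r, j)` is the occurrence of `r` with
the index `j`. -/
def occ (w : BalancedWord d J) : Fin d × J ≃ Fin d × J :=
  (Equiv.sigmaEquivProd (Fin d) J).symm.trans
    ((Equiv.sigmaCongrRight fun r => (w.2 r).some).trans (Equiv.sigmaFiberEquiv w.1))

theorem apply_occ (w : BalancedWord d J) (r : Fin d) (j : J) : w.1 (w.occ (r, j)) = r :=
  ((w.2 r).some j).2

/-- All balanced words have the same sum of letters, so a pointwise inequality is an equality. -/
theorem eq_of_le [Fintype J] (w w' : BalancedWord d J) (h : ∀ p, w.1 p ≤ w'.1 p) : w = w' := by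
  have hsum : ∀ v : BalancedWord d J, ∑ p, (v.1 p : ℕ) = ∑ p : Fin d × J, (p.1 : ℕ) := by
    intro v
    rw [← Equiv.sum_comp v.occ]
    exact Finset.sum_congr rfl fun p _ => by rw [apply_occ]
  have := (Finset.sum_eq_sum_iff_of_le (s := Finset.univ) (f := fun p => (w.1 p : ℕ))
    (g := fun p => (w'.1 p : ℕ)) fun p _ => h p).1 ((hsum w).trans (hsum w').symm)
  exact Subtype.ext (funext fun p => Fin.ext (this p (Finset.mem_univ p)))

/-- The number of balanced words is at least the `d`-th power of the largest number of words of
length `|J|` with a given content. -/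
theorem pow_le_card [Fintype J] [NeZero d] :
    ∃ U : ℕ, U ^ d ≤ Nat.card (BalancedWord d J) ∧
      d ^ Fintype.card J ≤ U * (Fintype.card J + 1) ^ d := by
  classical
  let content : (J → Fin d) → Fin d → Fin (Fintype.card J + 1) := fun u r =>
    ⟨Fintype.card {j // u j = r}, Nat.lt_succ_of_le (Fintype.card_subtype_le _)⟩
  -- Pigeonhole: there are at most (|J| + 1)^d contents.
  obtain ⟨y, hy⟩ : ∃ y, d ^ Fintype.card J ≤
      Fintype.card {u // content u = y} * (Fintype.card J + 1) ^ d := by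
    by_contra! hcon
    have h1 : Fintype.card (J → Fin d) = ∑ y, Fintype.card {u // content u = y} := by
      rw [← Fintype.card_sigma]
      exact Fintype.card_congr (Equiv.sigmaFiberEquiv content).symm
    have h2 : (∑ y, Fintype.card {u // content u = y}) * (Fintype.card J + 1) ^ d <
        ∑ y : Fin d → Fin (Fintype.card J + 1), d ^ Fintype.card J := by
      rw [Finset.sum_mul]
      exact Finset.sum_lt_sum_of_nonempty Finset.univ_nonempty fun y _ => hcon y
    rw [← h1] at h2
    simp [mul_comm] at h2
  refine ⟨_, ?_, hy⟩
  have hcard : ∀ u : {u // content u = y}, ∀ r, Fintype.card {j // u.1 j = r} = y r := by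
    intro u r
    exact congrArg Fin.val (congrFun u.2 r)
  have hne : ∀ u : Fin d → {u // content u = y}, ∑ r, (y r : ℕ) = Fintype.card J := by
    intro u
    simp only [← hcard (u 0)]
    rw [← Fintype.card_sigma]
    exact Fintype.card_congr (Equiv.sigmaFiberEquiv _)
  -- Shifting the a-th word cyclically by a balances the concatenation: the letter r occurs ∑ₐ y(r -
  -- a) = |J| times.
  let Φ : (Fin d → {u // content u = y}) → BalancedWord d J := fun u =>
    ⟨fun p => (u p.1).1 p.2 + p.1, fun r => by
      rw [← Fintype.card_eq]
      refine (hne u).symm.trans ?_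
      have e : {p : Fin d × J // (u p.1).1 p.2 + p.1 = r} ≃
          Σ a : Fin d, {j // (u a).1 j = r - a} :=
        { toFun := fun p => ⟨p.1.1, p.1.2, eq_sub_of_add_eq p.2⟩
          invFun := fun q => ⟨(q.1, q.2.1), by
            have := q.2.2
            simp [this]⟩
          left_inv := fun _ => rfl
          right_inv := fun _ => rfl }
      rw [Fintype.card_congr e, Fintype.card_sigma]
      simp only [hcard]
      exact (Equiv.sum_comp (Equiv.subLeft r) fun s => (y s : ℕ)).symm⟩
  have hΦ : Function.Injective Φ := by
    intro u u' h
    funext a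
    refine Subtype.ext (funext fun j => ?_)
    have := congrFun (congrArg Subtype.val h) (a, j)
    exact add_right_cancel this
  have := Nat.card_le_card_of_injective Φ hΦ
  simpa using this

end BalancedWord

/-! ### Columns that recover the words -/

/-- The cyclic shift by `r` on the set of `m` blocks. -/
def blockShift (m : ℕ) [NeZero m] (r : ℕ) : Equiv.Perm (Fin m) := Equiv.addRight (Fin.ofNat m r)

theorem blockShift_val {m : ℕ} [NeZero m] (r : ℕ) (k : Fin m) (h : k + r < m) :
    (blockShift m r k : ℕ) = k + r := by
  have hr : r < m := by omega
  simp [blockShift, Fin.val_add, Nat.mod_eq_of_lt h]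

/-- The position in the row `r` of the column `(k, j)` for the block words `w`: the occurrence of
the letter `r` with the index `j` in the block `k + r`. -/
def columnEquiv {d m : ℕ} [NeZero m] {J : Type} (w : Fin m → BalancedWord d J) :
    (Fin m × J) × Fin d ≃ Fin m × (Fin d × J) where
  toFun p := (blockShift m p.2 p.1.1, (w (blockShift m p.2 p.1.1)).occ (p.2, p.1.2))
  invFun q := (((blockShift m ((w q.1).occ.symm q.2).1).symm q.1, ((w q.1).occ.symm q.2).2),
    ((w q.1).occ.symm q.2).1)
  left_inv p := by simp
  right_inv q := by simp

/-- If the letters of `w'` in each column of `w` are distinct, then `w = w'`. -/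
theorem eq_of_columns_injective {d m : ℕ} [NeZero m] {J : Type} [Fintype J]
    (w w' : Fin m → BalancedWord d J) (h0 : ∀ k : Fin m, (k : ℕ) < d → w k = w' k)
    (h : ∀ c : Fin m × J, Function.Injective fun r : Fin d =>
      (w' (columnEquiv w (c, r)).1).1 (columnEquiv w (c, r)).2) : w = w' := by
  have key : ∀ n, ∀ k : Fin m, (k : ℕ) = n → w k = w' k := by
    intro n
    induction n using Nat.strong_induction_on with
    | _ n ih =>
      rintro k rfl
      rcases Nat.lt_or_ge k d with hk | hk
      · exact h0 k hk
      -- Let w have the letter r at p. The rows r' < r of the column through p lie in earlier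
      -- blocks, where w' = w by induction, so they carry the letters r' in w'. Distinctness forces
      -- the letter of w' at p to be at least r.
      refine BalancedWord.eq_of_le _ _ fun p => ?_
      obtain ⟨⟨r, j⟩, rfl⟩ := (w k).occ.surjective p
      rw [BalancedWord.apply_occ]
      have hr : (r : ℕ) < d := r.2
      let k₀ : Fin m := ⟨k - r, by omega⟩
      have hk₀ : (k₀ : ℕ) = k - r := rfl
      have hinj := h (k₀, j)
      have hval : ∀ r' : Fin d, r' ≤ r → (blockShift m r' k₀ : ℕ) = k - r + r' := by
        intro r' hr'
        have : (r' : ℕ) ≤ r := hr'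
        exact blockShift_val _ _ (by omega)
      have hsmall : ∀ r' : Fin d, r' < r →
          (w' (columnEquiv w ((k₀, j), r')).1).1 (columnEquiv w ((k₀, j), r')).2 = r' := by
        intro r' hr'
        have h1 := hval r' hr'.le
        have h2 : (r' : ℕ) < r := hr'
        simp only [columnEquiv, Equiv.coe_fn_mk]
        rw [← ih _ (by omega) (blockShift m r' k₀) rfl, BalancedWord.apply_occ]
      have hself : blockShift m r k₀ = k := Fin.ext (by rw [hval r le_rfl]; omega)
      by_contra! hlt
      have h3 := hsmall _ hlt
      have h4 : (w' (columnEquiv w ((k₀, j), r)).1).1 (columnEquiv w ((k₀, j), r)).2 =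
          (w' k).1 ((w k).occ (r, j)) := by
        simp only [columnEquiv, Equiv.coe_fn_mk, hself]
      exact hlt.ne (hinj (h3.trans h4.symm))
  funext k
  exact key _ k rfl

theorem det_basis_comp_eq_zero {V : Type*} [AddCommGroup V] [Module F V] {k : ℕ}
    (b : Module.Basis (Fin k) F V) {v : Fin k → Fin k} (hv : ¬ Function.Injective v) :
    b.det (fun i => b (v i)) = 0 :=
  AlternatingMap.map_eq_zero_of_not_injective _ _ fun h => hv fun _ _ hij =>
    h (congrArg b hij)

/-! ### The exponential lower bound -/

/-- The codimension is at least the number of families of `K` balanced words. -/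
theorem card_balancedWord_pow_le_codim [CharZero F] [FiniteDimensional F L]
    {ρ : H →ₐ[F] Module.End F L} (hρ : IsGeneralizedAction ρ)
    (hs : IsHSimple ρ) (hc : IsHCentral ρ) (hss : LieAlgebra.IsSemisimple F L)
    {d : ℕ} [NeZero d] (b : Module.Basis (Fin d) F L) :
    ∃ q : ℕ, ∀ N K n : ℕ, (d + K) * (d * (N * 2)) + q ≤ n →
      Nat.card (BalancedWord d (Fin N × Bool)) ^ K ≤ codim ρ n := by
  obtain ⟨q, hq⟩ := exists_isPoly_prod_det_smul hρ hs hc hss b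
  refine ⟨q, fun N K n hn => ?_⟩
  obtain ⟨c, hcard, g, hg, h⟩ := hq (n - (d + K) * (d * (N * 2))) (by omega)
  classical
  obtain ⟨w₀⟩ : Nonempty (BalancedWord d (Fin N × Bool)) := inferInstance
  have : NeZero (d + K) := ⟨by have := NeZero.ne d; omega⟩
  have : Fintype (BalancedWord d (Fin N × Bool)) := Fintype.ofFinite _
  let Ω : Type := Fin K → BalancedWord d (Fin N × Bool)
  -- The d fixed blocks in front start the induction in `eq_of_columns_injective`. The factor `Bool`
  -- in the index of the columns makes their number even.
  let ext : Ω → Fin (d + K) → BalancedWord d (Fin N × Bool) := fun w =>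
    Fin.append (fun _ => w₀) w
  have hext : Function.Injective ext := by
    intro w w' hw
    funext i
    simpa [ext] using congrFun hw (Fin.natAdd d i)
  let x : Fin (d + K) × (Fin d × (Fin N × Bool)) → Ω → L := fun p w => b ((ext w p.1).1 p.2)
  let s : Multiset (Ω → L) := Finset.univ.val.map x + consts Ω c
  have hscard : s.card = n := by
    simp [s, hcard]
    omega
  -- Only the grouping of the variables into columns depends on w; the multiset s does not.
  have hmem : ∀ w : Ω, (Pi.single w g : Ω → L) ∈ leftNormedSpan ρ s := by
    intro w
    let E : ((Fin (d + K) × Fin N) × Bool) × Fin d ≃ Fin (d + K) × (Fin d × (Fin N × Bool)) :=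
      (Equiv.prodCongr (Equiv.prodAssoc _ _ _) (Equiv.refl _)).trans (columnEquiv (ext w))
    have h1 := h Ω (Fin (d + K) × Fin N) fun c r => x (E (c, r))
    rw [map_univ_val_comp_equiv E x] at h1
    have e : (fun ω => (∏ c, b.det (fun i => x (E (c, i)) ω)) • g) = (Pi.single w g : Ω → L) := by
      funext w'
      rcases eq_or_ne w' w with rfl | hne
      · rw [Pi.single_eq_same, Finset.prod_eq_one, one_smul]
        intro c _
        rw [← b.det_self]
        congr 1
        funext r
        simp [x, E, columnEquiv, BalancedWord.apply_occ]
      · rw [Pi.single_eq_of_ne hne]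
        have : ¬ ∀ c : Fin (d + K) × (Fin N × Bool), Function.Injective fun r : Fin d =>
            (ext w' (columnEquiv (ext w) (c, r)).1).1 (columnEquiv (ext w) (c, r)).2 := by
          intro hinj
          refine hne (hext (eq_of_columns_injective _ _ (fun k hk => ?_) hinj)).symm
          obtain ⟨k, rfl⟩ : ∃ i : Fin d, k = Fin.castAdd K i := ⟨⟨k, hk⟩, rfl⟩
          simp [ext]
        push Not at this
        obtain ⟨c, hc⟩ := this
        rw [Finset.prod_eq_zero (Finset.mem_univ ((Equiv.prodAssoc _ _ _).symm c)), zero_smul]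
        exact det_basis_comp_eq_zero b hc
    rw [← e]
    exact h1.mem_leftNormedSpan
  have hli : LinearIndependent F fun w : Ω => (Pi.single w g : Ω → L) :=
    Pi.linearIndependent_single_of_ne_zero (fun _ => hg)
  rw [← hscard]
  refine le_trans ?_ (finrank_leftNormedSpan_le_codim ρ s)
  have hli' : LinearIndependent F fun w : Ω => (⟨_, hmem w⟩ : leftNormedSpan ρ s) :=
    LinearIndependent.of_comp (leftNormedSpan ρ s).subtype hli
  have := hli'.fintype_card_le_finrank
  simpa [Ω] using this

theorem two_le_finrank [FiniteDimensional F L] (h : ¬ IsLieAbelian L) :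
    2 ≤ Module.finrank F L := by
  by_contra! hlt
  obtain ⟨v, hv⟩ := finrank_le_one_iff.1 (Nat.le_of_lt_succ hlt)
  refine h ⟨fun x y => ?_⟩
  obtain ⟨a, rfl⟩ := hv x
  obtain ⟨a', rfl⟩ := hv y
  simp

/-- With a < a' < d, the gap between a' and d absorbs the polynomial loss in counting balanced
words, and the gap between a and a' absorbs the bounded part of the degree. -/
theorem eventually_pow_le_codim [CharZero F] [FiniteDimensional F L]
    {ρ : H →ₐ[F] Module.End F L} (hρ : IsGeneralizedAction ρ)
    (hs : IsHSimple ρ) (hc : IsHCentral ρ) (hss : LieAlgebra.IsSemisimple F L)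
    {a : ℝ} (ha : 1 < a) (had : a < Module.finrank F L) :
    ∀ᶠ n : ℕ in atTop, a ^ n < codim ρ n := by
  set d := Module.finrank F L with hd
  have : NeZero d := ⟨by rintro h; rw [h] at had; norm_num at had; linarith⟩
  obtain ⟨q, hq⟩ := card_balancedWord_pow_le_codim hρ hs hc hss (Module.finBasis F L)
  obtain ⟨a', haa', ha'd⟩ := exists_between had
  have ha'0 : 0 < a' := by linarith
  have h1 : 1 < (d : ℝ) / a' := (one_lt_div ha'0).2 ha'd
  obtain ⟨N, hN0, hN⟩ : ∃ N : ℕ, 0 < N ∧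
      (((N * 2 : ℕ) : ℝ) + 1) ^ d * a' ^ (N * 2) ≤ (d : ℝ) ^ (N * 2) := by
    have hlim := (tendsto_pow_const_div_const_pow_of_one_lt d h1).comp (tendsto_add_atTop_nat 1)
    obtain ⟨M, hM⟩ := eventually_atTop.1
      (hlim.eventually_lt_const (show (0 : ℝ) < ((d : ℝ) / a')⁻¹ by positivity))
    refine ⟨M + 1, by omega, ?_⟩
    have h2 := hM ((M + 1) * 2) (by omega)
    generalize (M + 1) * 2 = m at h2
    simp only [Function.comp_apply, Nat.cast_add, Nat.cast_one] at h2
    rw [div_lt_iff₀ (by positivity), pow_succ', inv_mul_cancel_left₀ (by positivity), div_pow,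
      lt_div_iff₀ (by positivity)] at h2
    exact h2.le
  obtain ⟨U, hU1, hU2⟩ := BalancedWord.pow_le_card (d := d) (J := Fin N × Bool)
  set B := Nat.card (BalancedWord d (Fin N × Bool)) with hB
  set D := d * (N * 2) with hD
  have hU : a' ^ (N * 2) ≤ U := by
    have h2 : ((d : ℝ)) ^ (N * 2) ≤ U * (((N * 2 : ℕ) : ℝ) + 1) ^ d := by
      have : d ^ (N * 2) ≤ U * (N * 2 + 1) ^ d := by simpa using hU2
      exact_mod_cast this
    have h3 : (0 : ℝ) < (((N * 2 : ℕ) : ℝ) + 1) ^ d := by positivity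
    nlinarith
  have hBa : a' ^ D ≤ B := by
    calc a' ^ D = (a' ^ (N * 2)) ^ d := by rw [← pow_mul, hD, mul_comm]
      _ ≤ (U : ℝ) ^ d := by gcongr
      _ ≤ B := by exact_mod_cast hU1
  have hD0 : 0 < D := by have := NeZero.pos d; positivity
  have hlow : ∀ n, q + (d + 1) * D ≤ n → a' ^ (n - (q + (d + 1) * D)) ≤ codim ρ n := by
    intro n hn
    obtain ⟨t, rfl⟩ := Nat.exists_eq_add_of_le hn
    -- K = ⌊t/D⌋ + 1 is large enough for KD ≥ t, while (d + K)D ≤ (d + 1)D + t still fits into the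
    -- degree.
    have h5 := hq N (t / D + 1) (q + (d + 1) * D + t) (by
      have := Nat.div_mul_le_self t D
      calc (d + (t / D + 1)) * D + q = t / D * D + (d + 1) * D + q := by ring
        _ ≤ _ := by omega)
    have h6 : t ≤ D * (t / D + 1) := by
      have := Nat.lt_mul_div_succ t hD0
      exact this.le
    calc a' ^ (q + (d + 1) * D + t - (q + (d + 1) * D)) = a' ^ t := by
          rw [Nat.add_sub_cancel_left]
      _ ≤ a' ^ (D * (t / D + 1)) := pow_le_pow_right₀ (by linarith) h6
      _ = (a' ^ D) ^ (t / D + 1) := pow_mul _ _ _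
      _ ≤ (B : ℝ) ^ (t / D + 1) := by gcongr
      _ ≤ _ := by exact_mod_cast h5
  generalize q + (d + 1) * D = c₀ at hlow
  have hratio : 1 < a' / a := (one_lt_div (by linarith)).2 haa'
  filter_upwards [eventually_ge_atTop c₀,
    (tendsto_pow_atTop_atTop_of_one_lt hratio).eventually_gt_atTop (a' ^ c₀)] with n hn hn'
  refine lt_of_lt_of_le ?_ (hlow n hn)
  rw [div_pow, lt_div_iff₀ (by positivity)] at hn'
  obtain ⟨t, rfl⟩ := Nat.exists_eq_add_of_le hn
  rw [Nat.add_sub_cancel_left]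
  rw [pow_add a' c₀ t] at hn'
  exact lt_of_mul_lt_mul_left hn' (by positivity)

end HLie

end

theorem mainTheorem2 {F H L : Type*} [Field F] [CharZero F]
    [Ring H] [Algebra F H] [FiniteDimensional F H]
    [LieRing L] [LieAlgebra F L] [FiniteDimensional F L]
    (ρ : H →ₐ[F] Module.End F L) (hρ : HLie.IsGeneralizedAction ρ)
    (hF : IsAlgClosed F ∨ HLie.IsHCentral ρ)
    (hsimple : HLie.IsHSimple ρ) (hss : LieAlgebra.IsSemisimple F L) :
    (∀ n : ℕ, HLie.codim ρ n ≤ Module.finrank F L ^ (n + 1)) ∧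
      HLie.HasHExponent ρ (Module.finrank F L : ℝ) := by
  have hc : HLie.IsHCentral ρ := hF.elim (fun _ => hsimple.isHCentral) id
  refine ⟨HLie.codim_le ρ, ?_⟩
  have hd2 : 2 ≤ Module.finrank F L := HLie.two_le_finrank hsimple.1
  set d := Module.finrank F L with hd
  have hdR : (2 : ℝ) ≤ d := by exact_mod_cast hd2
  refine tendsto_order.2 ⟨fun a ha => ?_, fun a ha => ?_⟩
  -- The maximum with 1 also covers small or negative a.
  · obtain ⟨a', ha', ha'd⟩ := exists_between (max_lt ha (by linarith : (1 : ℝ) < d))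
    have h1 : 1 < a' := (le_max_right _ _).trans_lt ha'
    filter_upwards [HLie.eventually_pow_le_codim hρ hsimple hc hss h1 ha'd,
      eventually_ge_atTop 1] with n hn hn1
    refine ((le_max_left a 1).trans_lt ha').trans_le ?_
    have : a' = (a' ^ n) ^ (1 / (n : ℝ)) := by
      rw [one_div, Real.pow_rpow_inv_natCast (by linarith) (by omega)]
    rw [this]
    exact Real.rpow_le_rpow (by positivity) hn.le (by positivity)
  · have hlim : Tendsto (fun n : ℕ => (d : ℝ) * (d : ℝ) ^ (1 / (n : ℝ))) atTop (𝓝 d) := by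
      have h0 : Tendsto (fun n : ℕ => 1 / (n : ℝ)) atTop (𝓝 0) := tendsto_one_div_atTop_nhds_zero_nat
      have := ((Real.continuousAt_const_rpow (a := (d : ℝ)) (b := 0) (by linarith)).tendsto.comp
        h0).const_mul (d : ℝ)
      simpa using this
    filter_upwards [hlim.eventually_lt_const ha, eventually_ge_atTop 1] with n hn hn1
    refine lt_of_le_of_lt ?_ hn
    have h1 : (HLie.codim ρ n : ℝ) ≤ (d : ℝ) ^ n * d := by
      rw [← pow_succ]
      exact_mod_cast HLie.codim_le ρ n
    calc (HLie.codim ρ n : ℝ) ^ (1 / (n : ℝ)) ≤ ((d : ℝ) ^ n * d) ^ (1 / (n : ℝ)) :=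
          Real.rpow_le_rpow (by positivity) h1 (by positivity)
      _ = (d : ℝ) * (d : ℝ) ^ (1 / (n : ℝ)) := by
          rw [Real.mul_rpow (by positivity) (by positivity), one_div,
            Real.pow_rpow_inv_natCast (by positivity) (by omega)]
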